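/- Let $G=(V,E)$ be a finite directed graph with $V=\{v_1,\dots,v_n\}$. Say that $u$ dominates $v$ if there is a (possibly trivial) directed path from $u$ to $v$; the closure $\langle X\rangle_G$ of $X\subseteq V$ is the set of all vertices dominated by elements of $X$. For $x\in\mathbb F_2^n$ put $w_G(x)=|\langle \mathrm{supp}(x)\rangle_G|$ and $d_G(x,y)=w_G(y-x)$, where $\mathrm{supp}(x)=\{v_i : x_i\neq 0\}$. Let $V'$ be the set of strongly connected components of $G$, let $\pi:V\to V'$ be the projection, and let $L'(a)=|\pi^{-1}(a)|$ for $a\in V'$. Let $P_G=(V',\preceq)$ be the poset in which $a\preceq b$ if the vertices of $b$ dominate those of $a$. The height of $a\in V'$ is the maximal cardinality of a chain in $P_G$ with greatest element $a$; $V'_i$ is the set of elements of $V'$ of height $i$, $V_i=\pi^{-1}(V'_i)$, and $h_G$ is the maximal height. The poset $P_G$ is called hierarchical if $b\preceq a$ whenever $i>1$, $a\in V'_i$ and $b\in V'_{i-1}$. - $G$ satisfies the Unique Decomposition Property (UDP) if, for every $i$ and all $S,S'\subseteq V'_i$ with $\sum_{a\in S}L'(a)=\sum_{b\in S'}L'(b)$,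 there is a bijection $g:S\to S'$ with $L'(a)=L'(g(a))$ for all $a\in S$. - A finite directed graph satisfies Condition $\Omega$ if, for every integer $k>1$, it has at most two strongly connected components with exactly $k$ vertices. - $(\mathbb F_2^n,d_G)$ satisfies the MacWilliams Extension Property if, for all linear codes $\mathcal C,\mathcal C'\subseteq\mathbb F_2^n$ and every linear map $t:\mathcal C\to\mathcal C'$ with $w_G(t(c))=w_G(c)$ for all $c\in\mathcal C$, there is a bijective linear map $T:\mathbb F_2^n\to\mathbb F_2^n$ with $d_G(T(x),T(y))=d_G(x,y)$ for all $x,y$ and $T|_{\mathcal C}=t$. Theorem. Suppose that $P_G$ is a hierarchical poset. Then $(\mathbb F_2^n,d_G)$ satisfies the MacWilliams Extension Property if and only if $G$ satisfies the UDP and, for each $1\le i\le h_G$, the graph $\Gamma(V_i)$ induced by $G$ on $V_i$ satisfies Condition $\Omega$. -/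

import Mathlib

namespace Digraph

variable {V : Type*} (G : Digraph V)

/-- `u` dominates `v`: there is a directed trail (possibly of length zero) from `u` to `v`.
Any directed walk can be shortened to a trail, so this is reachability along edges. Loops have no
influence on this relation. -/
def Dominates (u v : V) : Prop := Relation.ReflTransGen G.Adj u v

/-- `X` is closed: it contains every vertex dominated by one of its elements. -/
def IsClosedSet (X : Set V) : Prop := ∀ u ∈ X, ∀ v, G.Dominates u v → v ∈ X

/-- The closure `⟨X⟩_G`: the smallest closed set containing `X`. -/
def clo (X : Set V) : Set V := ⋂₀ {Y | G.IsClosedSet Y ∧ X ⊆ Y}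

theorem mem_clo {X : Set V} {v : V} : v ∈ G.clo X ↔ ∃ u ∈ X, G.Dominates u v := by
  constructor
  · intro h
    exact h {w | ∃ u ∈ X, G.Dominates u w}
      ⟨fun u ⟨a, ha, hau⟩ w huw => ⟨a, ha, Relation.ReflTransGen.trans hau huw⟩,
        fun u hu => ⟨u, hu, Relation.ReflTransGen.refl⟩⟩
  · rintro ⟨u, hu, huv⟩ Y ⟨hY, hXY⟩
    exact hY u (hXY hu) v huv

theorem mem_clo_singleton {u v : V} : v ∈ G.clo {u} ↔ G.Dominates u v := by
  simp [mem_clo]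

/-- The graph induced by `G` on a set of vertices. -/
def inducedOn (X : Set V) : Digraph X where
  Adj u v := G.Adj u v

/-! ### The reduced canonical form and its poset -/

/-- Two vertices are equivalent if they dominate each other; the classes are the strongly connected
components of `G`, that is, the maximal cliques of its expanded canonical form. -/
def sccSetoid : Setoid V where
  r u v := G.Dominates u v ∧ G.Dominates v u
  iseqv :=
    ⟨fun _ => ⟨.refl, .refl⟩, fun h => ⟨h.2, h.1⟩,
      fun h k => ⟨Relation.ReflTransGen.trans h.1 k.1, Relation.ReflTransGen.trans k.2 h.2⟩⟩

/-- The vertex set `V'` of the reduced canonical form, the underlying set of the poset `P_G`. -/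
def RedVert : Type _ := Quotient G.sccSetoid

/-- The projection `π : V → V'`. -/
def proj (v : V) : G.RedVert := Quotient.mk G.sccSetoid v

theorem proj_eq_iff {u v : V} : G.proj u = G.proj v ↔ G.Dominates u v ∧ G.Dominates v u :=
  Quotient.eq (r := G.sccSetoid)

/-- The weight `L'(a) = |π⁻¹(a)|`. -/
noncomputable def redWeight (a : G.RedVert) : ℕ := (G.proj ⁻¹' {a}).ncard

/-- The poset `P_G`: `a ≼ b` if some vertex of the component `a` lies in the closure of
some vertex of the component `b`. -/
instance : PartialOrder G.RedVert where
  le a b := ∃ u v, G.proj u = a ∧ G.proj v = b ∧ u ∈ G.clo {v}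
  le_refl a := by
    obtain ⟨u, rfl⟩ := Quotient.exists_rep a
    exact ⟨u, u, rfl, rfl, G.mem_clo_singleton.2 .refl⟩
  le_trans := by
    rintro a b c ⟨u, v, rfl, rfl, h⟩ ⟨v', w, h', rfl, k⟩
    rw [mem_clo_singleton] at h k
    exact ⟨u, w, rfl, rfl, G.mem_clo_singleton.2
      (Relation.ReflTransGen.trans (Relation.ReflTransGen.trans k (G.proj_eq_iff.1 h').1) h)⟩
  le_antisymm := by
    rintro a b ⟨u, v, rfl, rfl, h⟩ ⟨v', u', h₁, h₂, k⟩
    rw [mem_clo_singleton] at h k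
    exact G.proj_eq_iff.2 ⟨Relation.ReflTransGen.trans (G.proj_eq_iff.1 h₂).2
      (Relation.ReflTransGen.trans k (G.proj_eq_iff.1 h₁).1), h⟩

/-- The height of `a` in `P_G`: the maximal cardinality of a chain with greatest element `a`.
(`Order.height` counts the steps of such a chain, one less than its number of elements.) -/
noncomputable def redHeight (a : G.RedVert) : ℕ∞ := Order.height a + 1

/-- The number `h_G` of levels: the maximal height. -/
noncomputable def numLevels : ℕ∞ := ⨆ a : G.RedVert, G.redHeight a

/-- The `i`-th level `V'_i` of the reduced canonical form (nonempty only for `1 ≤ i ≤ h_G`). -/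
def redLevel (i : ℕ) : Set G.RedVert := {a | G.redHeight a = i}

/-- The `i`-th level `V_i = π⁻¹(V'_i)` of `G`. -/
def level (i : ℕ) : Set V := G.proj ⁻¹' G.redLevel i

/-- `P_G` is hierarchical: every element of a level lies above every element of the
level just below. -/
def IsHierarchical : Prop :=
  ∀ i : ℕ, 1 < i → ∀ a ∈ G.redLevel i, ∀ b ∈ G.redLevel (i - 1), b ≤ a

/-- The Unique Decomposition Property. -/
def UDP : Prop :=
  ∀ (i : ℕ) (S S' : Finset G.RedVert),
    (S : Set G.RedVert) ⊆ G.redLevel i → (S' : Set G.RedVert) ⊆ G.redLevel i →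
    ∑ a ∈ S, G.redWeight a = ∑ b ∈ S', G.redWeight b →
    ∃ g : S ≃ S', ∀ a : S, G.redWeight a = G.redWeight (g a)

/-- Condition `Ω`: for each `k > 1`, at most two vertices of the reduced canonical form have
weight `k`. -/
def ConditionOmega : Prop :=
  ∀ k : ℕ, 1 < k → {a : G.RedVert | G.redWeight a = k}.encard ≤ 2

/-! ### The graph metric on words indexed by the vertices -/

variable {F : Type*} [Field F]

/-- The `G`-weight `|⟨supp x⟩_G|` of a word. -/
noncomputable def wt (x : V → F) : ℕ := (G.clo (Function.support x)).ncard

/-- The `G`-distance. -/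
noncomputable def gdist (x y : V → F) : ℕ := G.wt (y - x)

variable (F)

/-- The group of linear isometries of the space of words with the `G`-distance. -/
def linIsom : Subgroup ((V → F) ≃ₗ[F] (V → F)) where
  carrier := {T | ∀ x y, G.gdist (T x) (T y) = G.gdist x y}
  one_mem' := fun _ _ => rfl
  mul_mem' := fun {S T} hS hT x y => (hS (T x) (T y)).trans (hT x y)
  inv_mem' := fun {T} hT x y => by
    have h := hT (T.symm x) (T.symm y)
    rw [T.apply_symm_apply, T.apply_symm_apply] at h
    exact h.symm

/-- The MacWilliams Extension Property: every weight-preserving linear map between linear codes is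
the restriction of a linear isometry of the whole space. -/
def MacWilliamsExtension : Prop :=
  ∀ (C C' : Submodule F (V → F)) (t : C →ₗ[F] C'),
    (∀ c : C, G.wt (t c : V → F) = G.wt (c : V → F)) →
    ∃ T ∈ G.linIsom F, ∀ c : C, T (c : V → F) = (t c : V → F)

end Digraph

/-!
For a hierarchical poset, the weight of a word depends only on the highest level that its support
meets and on the total size of the components of that level that it meets. Two words with the same
top level meet disjoint sets of components of that level exactly when the sizes of these sets add up
to that of their sum, so a linear isometry preserves disjointness, hence inclusion, hence permutes
the components of each level together with their sizes. If the UDP or Condition `Ω` fails,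
then some weight-preserving map on a code spanned by at most two words violates this.

Conversely, let `t` be a weight-preserving map on a code. By the UDP, a word and its image meet
equally many components of each size in their top level. The restrictions to the components of
size `1` are functionals, which the numbers of nonvanishing ones determine up to order by linear
independence of characters. For a size `k > 1` there are at most two components, and a pair of
subspaces is determined by its intersection and its union. This gives a permutation of the
components and isomorphisms between their spaces of words through which `t` acts on top levels. The
resulting isometry is corrected on smaller levels by means of a projection onto the code that
preserves the filtration by levels.
-/

section LinearAlgebra

section Lattice

variable {α : Type*} [Lattice α] [BoundedOrder α] [IsModularLattice α] [ComplementedLattice α]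
  (c : α) {w : ℕ → α}

theorem exists_disjoint_forall_le_inf_sup_inf (hw : Monotone w) (hw₀ : w 0 = ⊥) (m : ℕ) :
    ∃ d ≤ w m, Disjoint c d ∧ ∀ i ≤ m, w i ≤ c ⊓ w i ⊔ d ⊓ w i := by
  induction m with
  | zero => exact ⟨⊥, bot_le, disjoint_bot_right, fun i hi => by simp [Nat.le_zero.1 hi, hw₀]⟩
  | succ m ih =>
    obtain ⟨d, hdm, hcd, hd⟩ := ih
    have hwm : w m ≤ w (m + 1) := hw m.le_succ
    obtain ⟨e, hdisj, hsup⟩ :=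
      IsModularLattice.exists_disjoint_and_sup_eq (sup_le (inf_le_right (a := c)) hwm)
    have hde : d ⊔ e ≤ w (m + 1) := sup_le (hdm.trans hwm) (hsup ▸ le_sup_right)
    refine ⟨d ⊔ e, hde, ?_, fun i hi => ?_⟩
    · have hcde : Disjoint (c ⊓ w (m + 1)) (d ⊔ e) :=
        (hcd.mono_left inf_le_left).disjoint_sup_right_of_disjoint_sup_left
          (hdisj.mono_left (sup_le_sup_left hdm _))
      rwa [disjoint_iff, inf_assoc, inf_eq_right.2 hde, ← disjoint_iff] at hcde
    · rcases hi.lt_or_eq with hi | rfl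
      · exact (hd i (Nat.lt_succ_iff.1 hi)).trans
          (sup_le_sup_left (inf_le_inf_right _ le_sup_left) _)
      · rw [inf_eq_left.2 hde]
        calc w (m + 1) = c ⊓ w (m + 1) ⊔ w m ⊔ e := hsup.symm
          _ ≤ c ⊓ w (m + 1) ⊔ (c ⊓ w (m + 1) ⊔ d) ⊔ e :=
            sup_le_sup_right (sup_le_sup_left ((hd m le_rfl).trans
              (sup_le_sup (inf_le_inf_left _ hwm) inf_le_left)) _) _
          _ = c ⊓ w (m + 1) ⊔ (d ⊔ e) := by rw [← sup_assoc, sup_idem, sup_assoc]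

theorem exists_isCompl_forall_le_inf_sup_inf (hw : Monotone w) (hw₀ : w 0 = ⊥) {n : ℕ}
    (hn : w n = ⊤) : ∃ d, IsCompl c d ∧ ∀ i, w i ≤ c ⊓ w i ⊔ d ⊓ w i := by
  obtain ⟨d, -, hcd, hd⟩ := exists_disjoint_forall_le_inf_sup_inf c hw hw₀ n
  have htop : ⊤ ≤ c ⊔ d := by simpa [hn] using hd n le_rfl
  refine ⟨d, ⟨hcd, codisjoint_iff_le_sup.2 htop⟩, fun i => ?_⟩
  rcases le_total i n with hi | hi
  · exact hd i hi
  · rw [top_le_iff.1 (hn.symm.le.trans (hw hi)), inf_top_eq, inf_top_eq]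
    exact htop

end Lattice

variable {K : Type*} [DivisionRing K]

theorem exists_projection_map_mem {E : Type*} [AddCommGroup E] [Module K E] (C : Submodule K E)
    {W : ℕ → Submodule K E} (hW : Monotone W) (hW₀ : W 0 = ⊥) {n : ℕ} (hn : W n = ⊤) :
    ∃ P : E →ₗ[K] C, (∀ c : C, P c = c) ∧ ∀ i, ∀ x ∈ W i, (P x : E) ∈ W i := by
  obtain ⟨D, hCD, hD⟩ := exists_isCompl_forall_le_inf_sup_inf C hW hW₀ hn
  refine ⟨C.projectionOnto D hCD, C.projectionOnto_apply_left hCD, fun i x hx => ?_⟩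
  obtain ⟨c, ⟨hc, hci⟩, d, ⟨hd, -⟩, rfl⟩ := Submodule.mem_sup.1 (hD i hx)
  rwa [map_add, C.projectionOnto_apply_left hCD ⟨c, hc⟩,
    C.projectionOnto_apply_right hCD ⟨d, hd⟩, add_zero]

theorem exists_linearEquiv_apply_eq_of_ker_eq {D U U' : Type*} [AddCommGroup D] [Module K D]
    [AddCommGroup U] [Module K U] [AddCommGroup U'] [Module K U'] [FiniteDimensional K U]
    [FiniteDimensional K U'] (hU : Module.finrank K U = Module.finrank K U') {f : D →ₗ[K] U}
    {g : D →ₗ[K] U'} (hfg : LinearMap.ker f = LinearMap.ker g) :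
    ∃ e : U ≃ₗ[K] U', ∀ d, e (f d) = g d := by
  let e₀ := LinearEquiv.ofFinrankEq U U' hU
  have hker : LinearMap.ker g = LinearMap.ker (e₀.toLinearMap ∘ₗ f) := by
    rw [LinearEquiv.ker_comp, hfg]
  obtain ⟨e₁, he₁⟩ := Submodule.exists_linearEquiv_restrict_eq
    (g.quotKerEquivRange.symm ≪≫ₗ Submodule.quotEquivOfEq _ _ hker ≪≫ₗ
      (e₀.toLinearMap ∘ₗ f).quotKerEquivRange)
  have he₁' : ∀ d, e₀ (f d) = e₁ (g d) := fun d => by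
    rw [← he₁ ⟨g d, g.mem_range_self d⟩, LinearEquiv.trans_apply, LinearEquiv.trans_apply,
      g.quotKerEquivRange_symm_apply_image, Submodule.mkQ_apply, Submodule.quotEquivOfEq_mk,
      LinearMap.quotKerEquivRange_apply_mk]
    rfl
  exact ⟨e₀ ≪≫ₗ e₁.symm, fun d => e₁.symm_apply_eq.2 (he₁' d)⟩

end LinearAlgebra

section Permutations

variable {I Y : Type*}

theorem exists_perm_of_card_fiber_eq [Finite I] {f g : I → Y}
    (h : ∀ y, Nat.card {a // f a = y} = Nat.card {a // g a = y}) :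
    ∃ σ : Equiv.Perm I, ∀ a, g (σ a) = f a :=
  ⟨Equiv.ofFiberEquiv fun y => (Finite.card_eq.1 (h y)).some, Equiv.ofFiberEquiv_map _⟩

theorem exists_perm_forall_of_fiber (f : I → Y) {R : I → I → Prop}
    (h : ∀ y, ∃ σ : Equiv.Perm {a // f a = y}, ∀ a : {a // f a = y}, R a (σ a)) :
    ∃ σ : Equiv.Perm I, (∀ a, f (σ a) = f a) ∧ ∀ a, R a (σ a) := by
  choose σ hσ using h
  exact ⟨Equiv.ofFiberEquiv σ, Equiv.ofFiberEquiv_map σ, fun a => hσ (f a) ⟨a, rfl⟩⟩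

section Functionals

variable {D : Type*} [AddCommGroup D]

/-- The rational sign character `d ↦ (-1) ^ f d` of a functional `f` over the field with two
elements. -/
noncomputable def signChar (f : D →+ ZMod 2) : AddChar D ℚ :=
  (AddChar.zmodChar 2 (by norm_num : (-1 : ℚ) ^ 2 = 1)).compAddMonoidHom f

open Classical in
theorem signChar_apply (f : D →+ ZMod 2) (d : D) :
    signChar f d = 1 - 2 * if f d ≠ 0 then 1 else 0 := by
  rw [signChar, AddChar.compAddMonoidHom_apply, AddChar.zmodChar_apply]
  rcases (by decide : ∀ r : ZMod 2, r = 0 ∨ r = 1) (f d) with h | h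
  · simp [h]
  · simp only [h, ZMod.val_one]
    norm_num

theorem signChar_injective : Function.Injective (signChar (D := D)) := by
  classical
  intro f g hfg
  ext d
  have hzero : f d = 0 ↔ g d = 0 := by
    have hd := DFunLike.congr_fun hfg d
    rw [signChar_apply, signChar_apply] at hd
    split_ifs at hd with hf hg hg <;> first | tauto | norm_num at hd
  exact (by decide : ∀ r s : ZMod 2, (r = 0 ↔ s = 0) → r = s) _ _ hzero

theorem linearIndependent_signChar :
    LinearIndependent ℚ fun f : D →+ ZMod 2 => (signChar f : D → ℚ) :=
  (linearIndependent_monoidHom (Multiplicative D) ℚ).comp (fun f => (signChar f).toMonoidHom)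
    fun _ _ h => signChar_injective (AddChar.toMonoidHomEquiv.injective h)

theorem sum_signChar [Fintype I] (f : I → D →+ ZMod 2) (d : D) :
    ∑ a, signChar (f a) d = Fintype.card I - 2 * {a | f a d ≠ 0}.ncard := by
  classical
  simp only [signChar_apply, Finset.sum_sub_distrib, ← Finset.mul_sum, Finset.sum_boole,
    Set.ncard_eq_toFinset_card', Set.toFinset_ofPred]
  simp

theorem exists_perm_of_ncard_ne_zero_eq [Finite I] {f g : I → D →+ ZMod 2}
    (h : ∀ d, {a | f a d ≠ 0}.ncard = {a | g a d ≠ 0}.ncard) :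
    ∃ σ : Equiv.Perm I, ∀ a, g (σ a) = f a := by
  classical
  have := Fintype.ofFinite I
  have hcomb : ∀ f : I → D →+ ZMod 2, Finsupp.linearCombination ℚ
      (fun φ : D →+ ZMod 2 => (signChar φ : D → ℚ)) (∑ a, Finsupp.single (f a) 1) =
        fun d => (Fintype.card I - 2 * {a | f a d ≠ 0}.ncard : ℚ) := fun f => by
    ext d
    simp [map_sum, Finset.sum_apply, ← sum_signChar]
  have hfg := linearIndependent_signChar ((hcomb f).trans
    (by simp only [h] : _ = _) |>.trans (hcomb g).symm)
  refine exists_perm_of_card_fiber_eq fun φ => ?_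
  have hφ := DFunLike.congr_fun hfg φ
  simp only [Finsupp.finsetSum_apply, Finsupp.single_apply, Finset.sum_boole] at hφ
  rw [Nat.card_eq_fintype_card, Nat.card_eq_fintype_card, Fintype.card_subtype,
    Fintype.card_subtype]
  exact_mod_cast hφ

end Functionals

section Subspaces

variable {R D : Type*} [Ring R] [AddCommGroup D] [Module R D]

theorem pair_eq_or_eq_swap {K₁ K₂ L₁ L₂ : Submodule R D}
    (hand : ∀ d, d ∈ K₁ ∧ d ∈ K₂ ↔ d ∈ L₁ ∧ d ∈ L₂)
    (hor : ∀ d, d ∈ K₁ ∨ d ∈ K₂ ↔ d ∈ L₁ ∨ d ∈ L₂) :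
    L₁ = K₁ ∧ L₂ = K₂ ∨ L₁ = K₂ ∧ L₂ = K₁ := by
  have hcover : ∀ {H M N : Submodule R D}, (∀ d ∈ H, d ∈ M ∨ d ∈ N) → H ≤ M ∨ H ≤ N :=
    fun h => AddSubgroupClass.subset_union.1 h
  have hK₁ : K₁ ≤ L₁ ∨ K₁ ≤ L₂ := hcover fun d hd => (hor d).1 (Or.inl hd)
  have hK₂ : K₂ ≤ L₁ ∨ K₂ ≤ L₂ := hcover fun d hd => (hor d).1 (Or.inr hd)
  have hL₁ : L₁ ≤ K₁ ∨ L₁ ≤ K₂ := hcover fun d hd => (hor d).2 (Or.inl hd)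
  have hL₂ : L₂ ≤ K₁ ∨ L₂ ≤ K₂ := hcover fun d hd => (hor d).2 (Or.inr hd)
  simp only [le_antisymm_iff, SetLike.le_def] at *
  grind

theorem exists_perm_of_ncard_notMem_eq [Finite I] (hI : Nat.card I ≤ 2) {K L : I → Submodule R D}
    (h : ∀ d, {a | d ∉ K a}.ncard = {a | d ∉ L a}.ncard) :
    ∃ σ : Equiv.Perm I, ∀ a, L (σ a) = K a := by
  have hall : ∀ d, (∀ a, d ∈ K a) ↔ ∀ a, d ∈ L a := fun d => by
    have hempty : ∀ M : I → Submodule R D, (∀ a, d ∈ M a) ↔ {a | d ∉ M a}.ncard = 0 := fun M => by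
      rw [Set.ncard_eq_zero (Set.toFinite _), Set.eq_empty_iff_forall_notMem]
      simp only [Set.mem_ofPred, not_not]
    rw [hempty, hempty, h]
  have hex : ∀ d, (∃ a, d ∈ K a) ↔ ∃ a, d ∈ L a := fun d => by
    have huniv : ∀ M : I → Submodule R D,
        (¬∃ a, d ∈ M a) ↔ {a | d ∉ M a}.ncard = Nat.card I := fun M => by
      rw [← Set.eq_univ_iff_ncard, Set.eq_univ_iff_forall, not_exists]
      rfl
    rw [← not_iff_not, huniv, huniv, h]
  rcases hI.lt_or_eq with hI | hI
  · have : Subsingleton I := Finite.card_le_one_iff_subsingleton.1 (Nat.lt_succ_iff.1 hI)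
    refine ⟨Equiv.refl I, fun a => Submodule.ext fun d => ?_⟩
    have : Unique I := uniqueOfSubsingleton a
    simpa [Unique.forall_iff, Subsingleton.elim a default] using (hall d).symm
  · classical
    obtain ⟨a, b, -, hab⟩ := Nat.card_eq_two_iff.1 hI
    have hmem : ∀ c, c = a ∨ c = b := fun c => by simpa using hab.symm.subset (Set.mem_univ c)
    have hforall : ∀ {p : I → Prop}, (∀ c, p c) ↔ p a ∧ p b :=
      ⟨fun h => ⟨h a, h b⟩, fun h c => by rcases hmem c with rfl | rfl <;> tauto⟩
    have hexists : ∀ {p : I → Prop}, (∃ c, p c) ↔ p a ∨ p b :=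
      ⟨fun ⟨c, hc⟩ => by rcases hmem c with rfl | rfl <;> tauto, by rintro (h | h) <;> exact ⟨_, h⟩⟩
    simp only [hforall] at hall
    simp only [hexists] at hex
    rcases pair_eq_or_eq_swap hall hex with h | h
    · exact ⟨Equiv.refl I, hforall.2 h⟩
    · exact ⟨Equiv.swap a b, hforall.2 (by simpa using h.symm)⟩

end Subspaces

end Permutations

/-! ### Partitions with levels and their weight -/

/-- A partition of `V` into nonempty blocks, each of which is assigned a level. It records what the
weight of a graph with hierarchical poset depends on: the blocks are the strongly connected
components, and a vertex dominates its own block and all blocks of smaller level. -/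
structure LeveledPartition (V B : Type*) where
  block : V → B
  block_surjective : Function.Surjective block
  level : B → ℕ

namespace LeveledPartition

variable {V B : Type*} (P : LeveledPartition V B)

section Size

/-- The number of vertices in a union of blocks. -/
noncomputable def size (S : Set B) : ℕ := (P.block ⁻¹' S).ncard

variable [Finite V]

include P in
theorem finite_blocks : Finite B := Finite.of_surjective _ P.block_surjective

variable {P} {S S' : Set B}

theorem size_mono (h : S ⊆ S') : P.size S ≤ P.size S' :=
  Set.ncard_le_ncard (Set.preimage_mono h)

theorem size_eq_zero_iff : P.size S = 0 ↔ S = ∅ := by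
  rw [size, Set.ncard_eq_zero, Set.preimage_eq_empty_iff, P.block_surjective.range_eq,
    Set.disjoint_univ]

theorem size_union_add_size_inter :
    P.size (S ∪ S') + P.size (S ∩ S') = P.size S + P.size S' := by
  rw [size, size, Set.preimage_union, Set.preimage_inter, Set.ncard_union_add_ncard_inter]
  rfl

theorem size_union (h : Disjoint S S') : P.size (S ∪ S') = P.size S + P.size S' :=
  Set.ncard_union_eq (h.preimage _)

theorem sum_size_singleton (S : Finset B) : ∑ a ∈ S, P.size {a} = P.size S := by
  classical
  induction S using Finset.induction_on with
  | empty => simp [size]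
  | insert a S ha ih =>
    rw [Finset.sum_insert ha, ih, Finset.coe_insert, Set.insert_eq, size_union (by simpa)]

theorem size_preimage_perm {σ : Equiv.Perm B} (hσ : ∀ a, P.size {σ a} = P.size {a}) :
    P.size (σ ⁻¹' S) = P.size S := by
  have := P.finite_blocks
  rw [← (σ ⁻¹' S).toFinite.coe_toFinset, ← S.toFinite.coe_toFinset, ← sum_size_singleton,
    ← sum_size_singleton]
  exact Finset.sum_equiv σ (by simp) fun a _ => (hσ a).symm

end Size

section Weight

variable {K : Type*} [Field K] {x y : V → K} {i : ℕ} {a : B}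

/-- The number of vertices in the blocks that are met by the support of a word or have smaller
level than such a block. -/
noncomputable def weight (x : V → K) : ℕ :=
  {v | ∃ u, x u ≠ 0 ∧
    (P.block u = P.block v ∨ P.level (P.block v) < P.level (P.block u))}.ncard

/-- The words supported on the levels smaller than `i`. -/
def low (K : Type*) [Field K] (i : ℕ) : Submodule K (V → K) where
  carrier := {x | ∀ v, i ≤ P.level (P.block v) → x v = 0}
  zero_mem' _ _ := rfl
  add_mem' hx hy v hv := by simp [hx v hv, hy v hv]
  smul_mem' c x hx v hv := by simp [hx v hv]

/-- The blocks of level `i` that are met by the support of a word. -/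
def hits (i : ℕ) (x : V → K) : Set B := {a | P.level a = i ∧ ∃ v, P.block v = a ∧ x v ≠ 0}

/-- The blocks of level smaller than `i`. -/
def below (i : ℕ) : Set B := {a | P.level a < i}

variable {P}

theorem low_mono : Monotone (P.low K) := fun _ _ hij _ hx v hv => hx v (hij.trans hv)

theorem low_zero : P.low K 0 = ⊥ :=
  le_bot_iff.1 fun _ hx => funext fun v => hx v (Nat.zero_le _)

theorem exists_low_eq_top [Finite V] : ∃ n, P.low K n = ⊤ := by
  obtain ⟨n, hn⟩ := (Set.finite_range fun v => P.level (P.block v)).bddAbove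
  refine ⟨n + 1, top_le_iff.1 fun x _ v hv => ?_⟩
  exact absurd (hn ⟨v, rfl⟩) (not_le.2 hv)

theorem mem_low_iff_hits_eq_empty (hx : x ∈ P.low K (i + 1)) :
    x ∈ P.low K i ↔ P.hits i x = ∅ := by
  refine ⟨fun h => Set.eq_empty_iff_forall_notMem.2 ?_, fun h v hv => ?_⟩
  · rintro _ ⟨hi, v, rfl, hv⟩
    exact hv (h v hi.ge)
  · by_contra hxv
    have hvi : P.level (P.block v) < i + 1 := not_le.1 fun h => hxv (hx v h)
    exact h.subset (⟨by omega, v, rfl, hxv⟩ : P.block v ∈ P.hits i x)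

theorem exists_mem_low_succ_hits_nonempty [Finite V] (hx : x ≠ 0) :
    ∃ i, x ∈ P.low K (i + 1) ∧ (P.hits i x).Nonempty := by
  classical
  have hex : ∃ n, x ∈ P.low K n :=
    (exists_low_eq_top (P := P) (K := K)).imp fun n hn => by rw [hn]; exact Submodule.mem_top
  have hpos : Nat.find hex ≠ 0 := fun h => hx <| by
    have := Nat.find_spec hex
    rwa [h, low_zero, Submodule.mem_bot] at this
  obtain ⟨i, hi⟩ := Nat.exists_eq_succ_of_ne_zero hpos
  have hmem : x ∈ P.low K (i + 1) := by
    have := Nat.find_spec hex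
    rwa [hi] at this
  refine ⟨i, hmem, Set.nonempty_iff_ne_empty.2 fun h => ?_⟩
  exact Nat.find_min hex (by omega) ((mem_low_iff_hits_eq_empty hmem).2 h)

variable (P K) in
theorem exists_hits_eq_singleton (a : B) :
    ∃ e ∈ P.low K (P.level a + 1), P.hits (P.level a) e = {a} := by
  classical
  obtain ⟨v, rfl⟩ := P.block_surjective a
  refine ⟨Pi.single v 1, fun u hu => Pi.single_eq_of_ne (by rintro rfl; omega) _, ?_⟩
  ext a
  simp only [hits, Pi.single_apply]
  constructor
  · rintro ⟨-, u, rfl, hu⟩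
    simp_all
  · rintro rfl
    exact ⟨rfl, v, rfl, by simp⟩

theorem disjoint_below_hits : Disjoint (P.below i) (P.hits i x) :=
  Set.disjoint_left.2 fun _ ha hax => ha.ne hax.1

theorem hits_add_subset : P.hits i (x + y) ⊆ P.hits i x ∪ P.hits i y := by
  rintro a ⟨ha, v, hv, hxy⟩
  by_cases hx : x v = 0
  · exact Or.inr ⟨ha, v, hv, by simpa [hx] using hxy⟩
  · exact Or.inl ⟨ha, v, hv, hx⟩

theorem hits_add_of_disjoint (h : Disjoint (P.hits i x) (P.hits i y)) :
    P.hits i (x + y) = P.hits i x ∪ P.hits i y := by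
  refine hits_add_subset.antisymm (Set.union_subset ?_ ?_)
  · rintro a ⟨ha, v, hv, hx⟩
    have hy : y v = 0 := by_contra fun hy => h.notMem_of_mem_left ⟨ha, v, hv, hx⟩ ⟨ha, v, hv, hy⟩
    exact ⟨ha, v, hv, by simpa [hy] using hx⟩
  · rintro a ⟨ha, v, hv, hy⟩
    have hx : x v = 0 := by_contra fun hx => h.notMem_of_mem_left ⟨ha, v, hv, hx⟩ ⟨ha, v, hv, hy⟩
    exact ⟨ha, v, hv, by simpa [hx] using hy⟩

theorem weight_zero : P.weight (0 : V → K) = 0 := by simp [weight]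

variable [Finite V]

theorem disjoint_hits_iff : Disjoint (P.hits i x) (P.hits i y) ↔
    P.size (P.hits i (x + y)) = P.size (P.hits i x) + P.size (P.hits i y) := by
  refine ⟨fun h => by rw [hits_add_of_disjoint h, size_union h], fun h => ?_⟩
  have hle := size_mono (P := P) (hits_add_subset (P := P) (i := i) (x := x) (y := y))
  have hadd := size_union_add_size_inter (P := P) (S := P.hits i x) (S' := P.hits i y)
  rw [Set.disjoint_iff_inter_eq_empty, ← size_eq_zero_iff (P := P)]
  omega

theorem weight_eq (hx : x ∈ P.low K (i + 1)) (hne : (P.hits i x).Nonempty) :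
    P.weight x = P.size (P.below i) + P.size (P.hits i x) := by
  rw [← size_union disjoint_below_hits, weight, size]
  congr 1
  ext v
  constructor
  · rintro ⟨u, hu, huv⟩
    have hui : P.level (P.block u) ≤ i := by
      by_contra h
      exact hu (hx u (by omega))
    rcases huv with huv | huv
    · rw [huv] at hui
      exact hui.lt_or_eq.imp id fun h => ⟨h, u, huv, hu⟩
    · exact Or.inl (huv.trans_le hui)
  · rintro (hv | ⟨-, u, hu⟩)
    · obtain ⟨_, rfl, u, rfl, hu⟩ := hne
      exact ⟨u, hu, Or.inr hv⟩
    · exact ⟨u, hu.2, Or.inl hu.1⟩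

theorem mem_low_iff_weight_le : x ∈ P.low K i ↔ P.weight x ≤ P.size (P.below i) := by
  rcases eq_or_ne x 0 with rfl | hx
  · simp [weight_zero, zero_mem]
  obtain ⟨j, hj, hne⟩ := exists_mem_low_succ_hits_nonempty hx
  rw [weight_eq hj hne, ← size_union (disjoint_below_hits)]
  obtain ⟨_, rfl, v, rfl, hv⟩ := id hne
  rcases lt_or_ge (P.level (P.block v)) i with hi | hi
  · exact iff_of_true (low_mono hi hj) (size_mono (Set.union_subset
      (fun a ha => lt_trans ha hi) fun a ha => ha.1.trans_lt hi))
  · refine iff_of_false (fun hx => hv (hx v hi)) (not_le.2 ?_)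
    have hpos := Nat.pos_of_ne_zero (mt (size_eq_zero_iff (P := P)).1 hne.ne_empty)
    have hle : P.size (P.below i) ≤ P.size (P.below (P.level (P.block v))) :=
      size_mono fun a ha => lt_of_lt_of_le ha hi
    rw [size_union disjoint_below_hits]
    omega

theorem weight_eq_zero_iff : P.weight x = 0 ↔ x = 0 := by
  have hbelow : P.below 0 = ∅ := Set.eq_empty_of_forall_notMem fun _ => Nat.not_lt_zero _
  rw [← Submodule.mem_bot (M := V → K) K, ← low_zero (P := P), mem_low_iff_weight_le, hbelow,
    size_eq_zero_iff.2 rfl, Nat.le_zero]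

theorem size_hits_eq_tsub (hx : x ∈ P.low K (i + 1)) :
    P.size (P.hits i x) = P.weight x - P.size (P.below i) := by
  rcases (P.hits i x).eq_empty_or_nonempty with hempty | hne
  · rw [hempty, size_eq_zero_iff.2 rfl, eq_comm, tsub_eq_zero_iff_le, ← mem_low_iff_weight_le,
      mem_low_iff_hits_eq_empty hx, hempty]
  · rw [weight_eq hx hne, Nat.add_sub_cancel_left]

theorem weight_eq_of_size_hits_eq (hx : x ∈ P.low K (i + 1)) (hy : y ∈ P.low K (i + 1))
    (hne : (P.hits i x).Nonempty) (h : P.size (P.hits i y) = P.size (P.hits i x)) :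
    P.weight y = P.weight x := by
  have hne' : (P.hits i y).Nonempty := by
    rwa [Set.nonempty_iff_ne_empty, Ne, ← size_eq_zero_iff (P := P), h, size_eq_zero_iff, ← Ne,
      ← Set.nonempty_iff_ne_empty]
  rw [weight_eq hx hne, weight_eq hy hne', h]

end Weight

end LeveledPartition

/-! ### Linear isometries -/

namespace LeveledPartition

variable {V B : Type*} {P : LeveledPartition V B} {K : Type*} [Field K]

section Rigidity

variable {x y : V → K} {i : ℕ}

theorem hits_subset_iff : P.hits i x ⊆ P.hits i y ↔
    ∀ z ∈ P.low K (i + 1), Disjoint (P.hits i z) (P.hits i y) →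
      Disjoint (P.hits i z) (P.hits i x) := by
  refine ⟨fun h z _ hz => hz.mono_right h, fun h a ha => ?_⟩
  obtain rfl : P.level a = i := ha.1
  obtain ⟨e, he, hea⟩ := P.exists_hits_eq_singleton K a
  have hdisj := h e he
  rw [hea, Set.disjoint_singleton_left, Set.disjoint_singleton_left] at hdisj
  exact not_imp_not.1 hdisj ha

theorem weight_symm_apply {T : (V → K) ≃ₗ[K] (V → K)} (hT : ∀ x, P.weight (T x) = P.weight x)
    (x : V → K) : P.weight (T.symm x) = P.weight x := by
  rw [← hT, T.apply_symm_apply]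

variable [Finite V]

theorem mem_low_congr (h : P.weight x = P.weight y) : x ∈ P.low K i ↔ y ∈ P.low K i := by
  rw [mem_low_iff_weight_le, mem_low_iff_weight_le, h]

theorem size_hits_congr (h : P.weight x = P.weight y) (hx : x ∈ P.low K (i + 1)) :
    P.size (P.hits i x) = P.size (P.hits i y) := by
  rw [size_hits_eq_tsub hx, size_hits_eq_tsub ((mem_low_congr h).1 hx), h]

variable {T : (V → K) ≃ₗ[K] (V → K)} (hT : ∀ x, P.weight (T x) = P.weight x)
include hT

theorem disjoint_hits_map_iff (hx : x ∈ P.low K (i + 1)) (hy : y ∈ P.low K (i + 1)) :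
    Disjoint (P.hits i (T x)) (P.hits i (T y)) ↔ Disjoint (P.hits i x) (P.hits i y) := by
  have hsize : ∀ z ∈ P.low K (i + 1), P.size (P.hits i (T z)) = P.size (P.hits i z) :=
    fun z hz => (size_hits_congr (hT z).symm hz).symm
  rw [disjoint_hits_iff, disjoint_hits_iff, ← map_add, hsize x hx, hsize y hy,
    hsize _ (add_mem hx hy)]

theorem hits_map_subset_iff (hx : x ∈ P.low K (i + 1)) (hy : y ∈ P.low K (i + 1)) :
    P.hits i (T x) ⊆ P.hits i (T y) ↔ P.hits i x ⊆ P.hits i y := by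
  rw [hits_subset_iff, hits_subset_iff]
  constructor
  · intro h z hz hzy
    rw [← disjoint_hits_map_iff hT hz hx]
    exact h (T z) ((mem_low_congr (hT z)).2 hz) ((disjoint_hits_map_iff hT hz hy).2 hzy)
  · intro h z hz hzy
    have hz' : T.symm z ∈ P.low K (i + 1) := (mem_low_congr (weight_symm_apply hT z)).2 hz
    rw [← T.apply_symm_apply z] at hzy ⊢
    rw [disjoint_hits_map_iff hT hz' hx]
    exact h (T.symm z) hz' ((disjoint_hits_map_iff hT hz' hy).1 hzy)

theorem exists_hits_map_eq_singleton {a : B} (hx : x ∈ P.low K (P.level a + 1))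
    (hxa : P.hits (P.level a) x = {a}) :
    ∃ b, P.level b = P.level a ∧ P.size {b} = P.size {a} ∧ P.hits (P.level a) (T x) = {b} := by
  have hsize := size_hits_congr (hT x).symm hx
  obtain ⟨b, hb⟩ : (P.hits (P.level a) (T x)).Nonempty := by
    rw [Set.nonempty_iff_ne_empty, Ne, ← size_eq_zero_iff (P := P), ← hsize, hxa, size_eq_zero_iff]
    exact Set.singleton_ne_empty _
  have hba : P.level b = P.level a := hb.1
  obtain ⟨y, hy, hyb⟩ := P.exists_hits_eq_singleton K b
  rw [hba] at hy hyb
  have hTy : T.symm y ∈ P.low K (P.level a + 1) := (mem_low_congr (weight_symm_apply hT y)).2 hy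
  have hTy_nonempty : P.hits (P.level a) (T.symm y) ≠ ∅ := by
    rw [Ne, ← size_eq_zero_iff (P := P), size_hits_congr (weight_symm_apply hT y) hTy, hyb,
      size_eq_zero_iff]
    exact Set.singleton_ne_empty _
  have hTy_subset : P.hits (P.level a) (T.symm y) ⊆ P.hits (P.level a) x := by
    rwa [← hits_map_subset_iff hT hTy hx, T.apply_symm_apply, hyb, Set.singleton_subset_iff]
  have hTx : P.hits (P.level a) (T x) = {b} := by
    have hTy_eq : P.hits (P.level a) (T.symm y) = P.hits (P.level a) x := by
      rw [hxa] at hTy_subset ⊢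
      exact (Set.subset_singleton_iff_eq.1 hTy_subset).resolve_left hTy_nonempty
    rw [← hyb, ← T.apply_symm_apply y]
    exact ((hits_map_subset_iff hT hx hTy).2 hTy_eq.ge).antisymm
      ((hits_map_subset_iff hT hTy hx).2 hTy_eq.le)
  exact ⟨b, hba, by rw [← hTx, ← hsize, hxa], hTx⟩

theorem exists_perm_mem_hits_map_iff : ∃ σ : Equiv.Perm B,
    (∀ a, P.level (σ a) = P.level a) ∧ (∀ a, P.size {σ a} = P.size {a}) ∧
      ∀ a, ∀ x ∈ P.low K (P.level a + 1),
        σ a ∈ P.hits (P.level a) (T x) ↔ a ∈ P.hits (P.level a) x := by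
  have := P.finite_blocks
  choose e he hea using P.exists_hits_eq_singleton K
  choose σ hlevel hsize hσ using fun a => exists_hits_map_eq_singleton hT (he a) (hea a)
  have hmem : ∀ a, ∀ x ∈ P.low K (P.level a + 1),
      σ a ∈ P.hits (P.level a) (T x) ↔ a ∈ P.hits (P.level a) x := fun a x hx => by
    rw [← Set.singleton_subset_iff, ← hσ, hits_map_subset_iff hT (he a) hx, hea,
      Set.singleton_subset_iff]
  have hinj : Function.Injective σ := by
    intro a b hab
    have hba : P.level b = P.level a := by rw [← hlevel, ← hab, hlevel]
    have hb := hmem a (e b) (hba ▸ he b)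
    rw [hab, ← hba, hσ, hea] at hb
    exact hb.1 rfl
  exact ⟨Equiv.ofBijective σ (Finite.injective_iff_bijective.1 hinj), hlevel, hsize, hmem⟩

end Rigidity

section Extension

variable (P) in
/-- The MacWilliams extension property for the weight of a leveled partition: a weight-preserving
linear map defined on a code extends to a linear isometry of the whole space. -/
def ExtensionProperty (K : Type*) [Field K] : Prop :=
  ∀ (C : Submodule K (V → K)) (t : C →ₗ[K] (V → K)),
    (∀ c : C, P.weight (t c) = P.weight (c : V → K)) →
      ∃ T : (V → K) ≃ₗ[K] (V → K), (∀ x, P.weight (T x) = P.weight x) ∧ ∀ c : C, T c = t c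

namespace ExtensionProperty

variable [Finite V]

theorem exists_comp_eq (h : P.ExtensionProperty K) {D : Type*} [AddCommGroup D] [Module K D]
    {f g : D →ₗ[K] (V → K)} (hfg : ∀ d, P.weight (g d) = P.weight (f d)) :
    ∃ T : (V → K) ≃ₗ[K] (V → K), (∀ x, P.weight (T x) = P.weight x) ∧ ∀ d, T (f d) = g d := by
  obtain ⟨s, hs⟩ := f.rangeRestrict.exists_rightInverse_of_surjective f.range_rangeRestrict
  have hfs : ∀ c : LinearMap.range f, f (s c) = c := fun c =>
    congrArg Subtype.val (LinearMap.congr_fun hs c)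
  have hgs : ∀ d, g (s (f.rangeRestrict d)) = g d := fun d => by
    have hfd : f (s (f.rangeRestrict d)) = f d := hfs (f.rangeRestrict d)
    rw [← sub_eq_zero, ← map_sub, ← weight_eq_zero_iff (P := P), hfg, map_sub, hfd, sub_self,
      weight_zero]
  obtain ⟨T, hT, hTg⟩ := h (LinearMap.range f) (g ∘ₗ s) fun c => by
    rw [LinearMap.comp_apply, hfg, hfs]
  exact ⟨T, hT, fun d => (hTg (f.rangeRestrict d)).trans (hgs d)⟩

theorem exists_map_pair_eq (h : P.ExtensionProperty (ZMod 2)) {x y x' y' : V → ZMod 2}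
    (hx : P.weight x' = P.weight x) (hy : P.weight y' = P.weight y)
    (hxy : P.weight (x' + y') = P.weight (x + y)) :
    ∃ T : (V → ZMod 2) ≃ₗ[ZMod 2] (V → ZMod 2),
      (∀ z, P.weight (T z) = P.weight z) ∧ T x = x' ∧ T y = y' := by
  let comb (u v : V → ZMod 2) : ZMod 2 × ZMod 2 →ₗ[ZMod 2] (V → ZMod 2) :=
    (LinearMap.toSpanSingleton (ZMod 2) _ u).coprod (LinearMap.toSpanSingleton (ZMod 2) _ v)
  have hcomb : ∀ d, P.weight (comb x' y' d) = P.weight (comb x y d) := by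
    have hF : ∀ r : ZMod 2, r = 0 ∨ r = 1 := by decide
    rintro ⟨r, s⟩
    rcases hF r with rfl | rfl <;> rcases hF s with rfl | rfl <;> simp [comb, *]
  obtain ⟨T, hT, hTcomb⟩ := h.exists_comp_eq hcomb
  exact ⟨T, hT, by simpa [comb] using hTcomb (1, 0), by simpa [comb] using hTcomb (0, 1)⟩

end ExtensionProperty

end Extension

end LeveledPartition

/-! ### Necessity -/

namespace LeveledPartition

section Indicator

variable {V B : Type*} {P : LeveledPartition V B} {K : Type*} [Field K] {X Y : Set V} {i : ℕ}

theorem indicator_mem_low (hX : ∀ v ∈ X, P.level (P.block v) = i) :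
    X.indicator 1 ∈ P.low K (i + 1) := fun v hv =>
  Set.indicator_of_notMem (fun hvX => by have := hX v hvX; omega) _

theorem hits_indicator (hX : ∀ v ∈ X, P.level (P.block v) = i) :
    P.hits i (X.indicator (1 : V → K)) = P.block '' X := by
  ext a
  constructor
  · rintro ⟨-, v, rfl, hv⟩
    exact ⟨v, Set.mem_of_indicator_ne_zero hv, rfl⟩
  · rintro ⟨v, hv, rfl⟩
    exact ⟨hX v hv, v, rfl, by simp [hv]⟩

theorem weight_indicator_eq [Finite V] (hX : ∀ v ∈ X, P.level (P.block v) = i)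
    (hY : ∀ v ∈ Y, P.level (P.block v) = i) (h : P.size (P.block '' Y) = P.size (P.block '' X)) :
    P.weight (Y.indicator (1 : V → K)) = P.weight (X.indicator (1 : V → K)) := by
  rcases X.eq_empty_or_nonempty with rfl | hne
  · rw [Set.image_empty, size_eq_zero_iff.2 rfl, size_eq_zero_iff, Set.image_eq_empty] at h
    rw [h]
  · refine weight_eq_of_size_hits_eq (indicator_mem_low hX) (indicator_mem_low hY) ?_ ?_
    · rw [hits_indicator hX]
      exact hne.image _
    · rw [hits_indicator hX, hits_indicator hY, h]

end Indicator

section Necessity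

variable {V B : Type*} (P : LeveledPartition V B)

/-- The Unique Decomposition Property of a leveled partition: the number of vertices in a union of
blocks of one level determines how many blocks of each size occur in it. -/
def UniqueDecomposition : Prop :=
  ∀ (i : ℕ) (S S' : Set B), (∀ a ∈ S, P.level a = i) → (∀ a ∈ S', P.level a = i) →
    P.size S = P.size S' → ∃ g : S ≃ S', ∀ a, P.size {(g a : B)} = P.size {(a : B)}

/-- Condition `Ω`, level by level: a level contains at most two blocks of each size greater
than one. -/
def LevelwiseOmega : Prop :=
  ∀ i k : ℕ, 1 < k → {a | P.level a = i ∧ P.size {a} = k}.encard ≤ 2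

variable {P} [Finite V]

theorem ExtensionProperty.uniqueDecomposition (h : P.ExtensionProperty (ZMod 2)) :
    P.UniqueDecomposition := by
  intro i S S' hS hS' hsize
  have hlevel : ∀ {R : Set B}, (∀ a ∈ R, P.level a = i) →
      ∀ v ∈ P.block ⁻¹' R, P.level (P.block v) = i := fun hR v hv => hR _ hv
  have himage : ∀ R, P.block '' (P.block ⁻¹' R) = R := P.block_surjective.image_preimage
  have hweight := weight_indicator_eq (K := ZMod 2) (hlevel hS) (hlevel hS')
    (by rw [himage, himage, hsize])
  obtain ⟨T, hT, hTS, -⟩ := h.exists_map_pair_eq hweight (rfl : P.weight 0 = P.weight 0)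
    (by rwa [add_zero, add_zero])
  obtain ⟨σ, hσlevel, hσsize, hσ⟩ := exists_perm_mem_hits_map_iff hT
  have hmem : ∀ a, P.level a = i → (σ a ∈ S' ↔ a ∈ S) := by
    rintro a rfl
    have := hσ a _ (indicator_mem_low (hlevel hS))
    rwa [hTS, hits_indicator (hlevel hS), hits_indicator (hlevel hS'), himage, himage] at this
  refine ⟨σ.subtypeEquiv fun a => ⟨fun ha => (hmem a (hS a ha)).2 ha, fun ha => ?_⟩,
    fun a => hσsize a⟩
  exact (hmem a ((hσlevel a).symm.trans (hS' _ ha))).1 ha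

theorem ExtensionProperty.image_block_subset (h : P.ExtensionProperty (ZMod 2)) {i : ℕ}
    {X Y X' Y' : Set V} (hX : ∀ v ∈ X, P.level (P.block v) = i)
    (hY : ∀ v ∈ Y, P.level (P.block v) = i) (hX' : ∀ v ∈ X', P.level (P.block v) = i)
    (hY' : ∀ v ∈ Y', P.level (P.block v) = i)
    (hsizeX : P.size (P.block '' X') = P.size (P.block '' X))
    (hsizeY : P.size (P.block '' Y') = P.size (P.block '' Y))
    (hsizeXY : P.size (P.block '' symmDiff X' Y') = P.size (P.block '' symmDiff X Y))
    (hYX : P.block '' Y ⊆ P.block '' X) : P.block '' Y' ⊆ P.block '' X' := by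
  have hadd : ∀ Z W : Set V, Z.indicator 1 + W.indicator 1 =
      (symmDiff Z W).indicator (1 : V → ZMod 2) := fun Z W => by
    ext v
    by_cases hZ : v ∈ Z <;> by_cases hW : v ∈ W <;>
      simp [Set.mem_symmDiff, hZ, hW, CharTwo.add_self_eq_zero]
  have hlevel : ∀ {Z W : Set V}, (∀ v ∈ Z, P.level (P.block v) = i) →
      (∀ v ∈ W, P.level (P.block v) = i) → ∀ v ∈ symmDiff Z W, P.level (P.block v) = i :=
    fun hZ hW v hv => hv.elim (fun hv => hZ v hv.1) fun hv => hW v hv.1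
  obtain ⟨T, hT, hTX, hTY⟩ := h.exists_map_pair_eq (weight_indicator_eq hX hX' hsizeX)
    (weight_indicator_eq hY hY' hsizeY)
    (by rw [hadd, hadd]; exact weight_indicator_eq (hlevel hX hY) (hlevel hX' hY') hsizeXY)
  rwa [← hits_indicator (K := ZMod 2) hX, ← hits_indicator (K := ZMod 2) hY,
    ← hits_map_subset_iff hT (indicator_mem_low hY) (indicator_mem_low hX), hTX, hTY,
    hits_indicator hX', hits_indicator hY'] at hYX

theorem ExtensionProperty.levelwiseOmega (h : P.ExtensionProperty (ZMod 2)) :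
    P.LevelwiseOmega := by
  have := P.finite_blocks
  intro i k hk
  rw [← not_lt, ← Set.Finite.cast_ncard_eq (Set.toFinite _)]
  intro hlt
  obtain ⟨a, b, c, ⟨hla, hka⟩, ⟨hlb, hkb⟩, ⟨hlc, hkc⟩, hab, hac, hbc⟩ :=
    (Set.two_lt_ncard_iff (Set.toFinite _)).1 (by exact_mod_cast hlt)
  have htwo : ∀ d, P.size {d} = k → ∃ v w, P.block v = d ∧ P.block w = d ∧ v ≠ w := fun d hd =>
    (Set.one_lt_ncard_iff (Set.toFinite _)).1 (hk.trans_eq hd.symm)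
  obtain ⟨a₁, a₂, ha₁, ha₂, ha⟩ := htwo a hka
  obtain ⟨b₁, b₂, hb₁, hb₂, hb⟩ := htwo b hkb
  obtain ⟨c₁, -, hc₁, -, -⟩ := htwo c hkc
  have hsize : ∀ {d e}, d ≠ e → P.size {d} = k → P.size {e} = k → P.size {d, e} = k + k :=
    fun hde hd he => by rw [Set.insert_eq, size_union (by simpa using hde), hd, he]
  -- The words with supports `{a₁, b₁}` and `{a₂, b₂}` meet the same two blocks as their sum, while
  -- those with supports `{a₁, b₁}` and `{b₁, c₁}` and their sum meet three pairs of blocks.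
  have hsub := h.image_block_subset (i := i) (X := {a₁, b₁}) (Y := {a₂, b₂}) (X' := {a₁, b₁})
    (Y' := {b₁, c₁}) (by simp [*]) (by simp [*]) (by simp [*]) (by simp [*]) rfl
    (by rw [Set.image_pair, Set.image_pair, ha₂, hb₂, hb₁, hc₁, hsize hab hka hkb,
      hsize hbc hkb hkc])
    ?_ (by rw [Set.image_pair, Set.image_pair, ha₁, hb₁, ha₂, hb₂])
  · rw [Set.image_pair, Set.image_pair, ha₁, hb₁, hc₁] at hsub
    rcases hsub (Or.inr rfl) with hca | hcb
    exacts [hac hca.symm, hbc (Set.mem_singleton_iff.1 hcb).symm]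
  · have hX : symmDiff {a₁, b₁} {a₂, b₂} = ({a₁, a₂, b₁, b₂} : Set V) := by grind
    have hX' : symmDiff {a₁, b₁} {b₁, c₁} = ({a₁, c₁} : Set V) := by grind
    rw [hX, hX', Set.image_pair, ha₁, hc₁, hsize hac hka hkc]
    simp [Set.image_insert_eq, ha₁, ha₂, hb₁, hb₂, hsize hab hka hkb]

end Necessity

end LeveledPartition

/-! ### Sufficiency -/

theorem exists_perm_ker_eq {D I : Type*} [AddCommGroup D] [Module (ZMod 2) D] [Finite I]
    {X : I → Type*} [∀ a, Finite (X a)] (hI : (∀ a, Subsingleton (X a)) ∨ Nat.card I ≤ 2)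
    {f g : ∀ a, D →ₗ[ZMod 2] (X a → ZMod 2)}
    (h : ∀ d, {a | f a d ≠ 0}.ncard = {a | g a d ≠ 0}.ncard) :
    ∃ σ : Equiv.Perm I, ∀ a, LinearMap.ker (g (σ a)) = LinearMap.ker (f a) := by
  rcases hI with hX | hI
  · have := fun a => Fintype.ofFinite (X a)
    let total (f : ∀ a, D →ₗ[ZMod 2] (X a → ZMod 2)) (a : I) : D →+ ZMod 2 :=
      ((∑ v, LinearMap.proj v) ∘ₗ f a).toAddMonoidHom
    have htotal : ∀ f a d, total f a d = 0 ↔ f a d = 0 := fun f a d => by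
      have hsum : ∀ x : X a → ZMod 2, ∑ v, x v = 0 ↔ x = 0 := fun x => by
        refine ⟨fun hx => funext fun v => ?_, fun hx => by simp [hx]⟩
        rwa [Fintype.sum_subsingleton _ v] at hx
      simpa [total] using hsum (f a d)
    obtain ⟨σ, hσ⟩ := exists_perm_of_ncard_ne_zero_eq (f := total f) (g := total g)
      (by simpa only [Ne, htotal] using h)
    refine ⟨σ, fun a => Submodule.ext fun d => ?_⟩
    rw [LinearMap.mem_ker, LinearMap.mem_ker, ← htotal, ← htotal, hσ]
  · exact exists_perm_of_ncard_notMem_eq hI (K := fun a => LinearMap.ker (f a))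
      (L := fun a => LinearMap.ker (g a)) h

namespace LeveledPartition

variable {V B : Type*} (P : LeveledPartition V B)

section Restriction

variable {K : Type*} [Field K] {x : V → K} {i : ℕ} {a : B}

/-- The restriction of words to a block. -/
def restrict (a : B) : (V → K) →ₗ[K] ({v // P.block v = a} → K) :=
  LinearMap.funLeft K K Subtype.val

/-- The linear map that moves the restriction of a word to the block `a` to the block `σ a` by the
isomorphism `E a`, for every block `a`. -/
def glue (σ : Equiv.Perm B)
    (E : ∀ a, ({v // P.block v = a} → K) ≃ₗ[K] ({v // P.block v = σ a} → K)) :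
    (V → K) →ₗ[K] (V → K) :=
  LinearMap.pi fun v =>
    LinearMap.proj (⟨v, by simp⟩ : {u // P.block u = σ (σ.symm (P.block v))}) ∘ₗ
      (E (σ.symm (P.block v))).toLinearMap ∘ₗ P.restrict (σ.symm (P.block v))

variable {P}

theorem restrict_glue (σ : Equiv.Perm B)
    (E : ∀ a, ({v // P.block v = a} → K) ≃ₗ[K] ({v // P.block v = σ a} → K)) (x : V → K) (a : B) :
    P.restrict (σ a) (P.glue σ E x) = E a (P.restrict a x) := by
  ext ⟨v, hv⟩
  obtain rfl : a = σ.symm (P.block v) := by simp [hv]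
  rfl

theorem restrict_eq_zero_iff : P.restrict a x = 0 ↔ ∀ v, P.block v = a → x v = 0 :=
  ⟨fun h v hv => congrFun h ⟨v, hv⟩, fun h => funext fun v => h v v.2⟩

theorem mem_hits_iff_restrict_ne_zero :
    a ∈ P.hits i x ↔ P.level a = i ∧ P.restrict a x ≠ 0 := by
  simp [hits, restrict_eq_zero_iff]

theorem mem_low_iff_restrict_eq_zero :
    x ∈ P.low K i ↔ ∀ a, i ≤ P.level a → P.restrict a x = 0 := by
  simp only [restrict_eq_zero_iff]
  exact ⟨fun h a ha v hv => h v (hv ▸ ha), fun h v hv => h _ hv v rfl⟩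

end Restriction

section Isometry

variable {P}

theorem exists_linearEquiv_restrict_eq [Finite V] {K D : Type*} [Field K] [AddCommGroup D]
    [Module K D] {f g : D →ₗ[K] (V → K)} {a b : B} (hab : P.size {b} = P.size {a})
    (h : ∀ d, P.restrict b (g d) = 0 ↔ P.restrict a (f d) = 0) :
    ∃ E : ({v // P.block v = a} → K) ≃ₗ[K] ({v // P.block v = b} → K),
      ∀ d, E (P.restrict a (f d)) = P.restrict b (g d) := by
  classical
  have := Fintype.ofFinite V
  have hker : LinearMap.ker (P.restrict a ∘ₗ f) = LinearMap.ker (P.restrict b ∘ₗ g) :=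
    Submodule.ext fun d => (h d).symm
  refine exists_linearEquiv_apply_eq_of_ker_eq ?_ hker
  rw [Module.finrank_fintype_fun_eq_card, Module.finrank_fintype_fun_eq_card,
    ← Nat.card_eq_fintype_card, ← Nat.card_eq_fintype_card]
  exact hab.symm

variable [Finite V] {K : Type*} [Field K] {σ : Equiv.Perm B}
  (hlevel : ∀ a, P.level (σ a) = P.level a) (hsize : ∀ a, P.size {σ a} = P.size {a})
include hlevel hsize

theorem weight_map_eq {T : (V → K) →ₗ[K] (V → K)}
    (hT : ∀ a, ∀ x ∈ P.low K (P.level a + 1),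
      P.restrict (σ a) (T x) = 0 ↔ P.restrict a x = 0) (x : V → K) :
    P.weight (T x) = P.weight x := by
  rcases eq_or_ne x 0 with rfl | hx
  · rw [map_zero]
  obtain ⟨i, hxi, hne⟩ := exists_mem_low_succ_hits_nonempty (P := P) hx
  have hTx : T x ∈ P.low K (i + 1) := by
    rw [mem_low_iff_restrict_eq_zero] at hxi ⊢
    refine σ.forall_congr_right.1 fun a ha => ?_
    rw [hlevel] at ha
    rw [hT a x (low_mono (ha.trans (Nat.le_succ _)) (mem_low_iff_restrict_eq_zero.2 hxi))]
    exact hxi a ha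
  have hhits : σ ⁻¹' P.hits i (T x) = P.hits i x := by
    ext a
    rw [Set.mem_preimage, mem_hits_iff_restrict_ne_zero, mem_hits_iff_restrict_ne_zero, hlevel]
    refine and_congr_right fun ha => not_congr (hT a x ?_)
    rwa [ha]
  exact weight_eq_of_size_hits_eq hxi hTx hne (by rw [← hhits, size_preimage_perm hsize])

theorem exists_isometry_apply_eq {C : Submodule K (V → K)} {t : C →ₗ[K] (V → K)}
    (ht : ∀ a, ∀ c : C, (c : V → K) ∈ P.low K (P.level a + 1) →
      (P.restrict (σ a) (t c) = 0 ↔ P.restrict a (c : V → K) = 0)) :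
    ∃ T : (V → K) ≃ₗ[K] (V → K), (∀ x, P.weight (T x) = P.weight x) ∧ ∀ c : C, T c = t c := by
  have hE : ∀ a, ∃ E : ({v // P.block v = a} → K) ≃ₗ[K] ({v // P.block v = σ a} → K),
      ∀ c : C, (c : V → K) ∈ P.low K (P.level a + 1) →
        E (P.restrict a (c : V → K)) = P.restrict (σ a) (t c) := fun a => by
    let D : Submodule K C := (P.low K (P.level a + 1)).comap C.subtype
    obtain ⟨E, hE⟩ := exists_linearEquiv_restrict_eq (D := D) (f := C.subtype ∘ₗ D.subtype)
      (g := t ∘ₗ D.subtype) (hsize a) fun c => ht a c c.2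
    exact ⟨E, fun c hc => hE ⟨c, hc⟩⟩
  choose E hE using hE
  obtain ⟨n, hn⟩ := exists_low_eq_top (P := P) (K := K)
  obtain ⟨π, hπC, hπ⟩ := exists_projection_map_mem C (low_mono (P := P)) low_zero hn
  -- On the top level of a word in `C` the map `t` acts as `glue σ E`. As `π` preserves the
  -- filtration, the correction that makes `T` agree with `t` on `C` only changes smaller levels.
  let T : (V → K) →ₗ[K] (V → K) := P.glue σ E + (t - P.glue σ E ∘ₗ C.subtype) ∘ₗ π
  have hT : ∀ x, T x = P.glue σ E x + (t (π x) - P.glue σ E (π x)) := fun x => rfl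
  have hrestrict : ∀ a, ∀ x ∈ P.low K (P.level a + 1),
      P.restrict (σ a) (T x) = E a (P.restrict a x) := fun a x hx => by
    rw [hT, map_add, map_sub, restrict_glue, restrict_glue, hE a (π x) (hπ _ x hx), sub_self,
      add_zero]
  have hweight : ∀ x, P.weight (T x) = P.weight x := weight_map_eq hlevel hsize fun a x hx => by
    rw [hrestrict a x hx, (E a).map_eq_zero_iff]
  have hinj : Function.Injective T := (injective_iff_map_eq_zero T).2 fun x hx => by
    rw [← weight_eq_zero_iff (P := P), ← hweight, hx, weight_zero]
  refine ⟨LinearEquiv.ofInjectiveEndo T hinj, hweight, fun c => ?_⟩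
  rw [LinearEquiv.coe_ofInjectiveEndo, hT, hπC, add_sub_cancel]

end Isometry

section Sufficiency

variable {P}

theorem UniqueDecomposition.ncard_size_eq (hU : P.UniqueDecomposition) {i : ℕ} {S S' : Set B}
    (hS : ∀ a ∈ S, P.level a = i) (hS' : ∀ a ∈ S', P.level a = i) (h : P.size S = P.size S')
    (k : ℕ) : {a ∈ S | P.size {a} = k}.ncard = {a ∈ S' | P.size {a} = k}.ncard := by
  obtain ⟨g, hg⟩ := hU i S S' hS hS' h
  refine Set.ncard_congr (fun a ha => (g ⟨a, ha.1⟩ : B))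
    (fun a ha => ⟨(g _).2, (hg _).trans ha.2⟩)
    (fun a b ha hb hab => congrArg Subtype.val (g.injective (Subtype.ext hab))) fun b hb => ?_
  obtain ⟨a, ha⟩ := g.surjective ⟨b, hb.1⟩
  refine ⟨a, ⟨a.2, ?_⟩, congrArg Subtype.val ha⟩
  rw [← hg, ha]
  exact hb.2

variable [Finite V]

theorem exists_perm_fiber_restrict_eq_zero_iff {D : Type*} [AddCommGroup D] [Module (ZMod 2) D]
    {f g : D →ₗ[ZMod 2] (V → ZMod 2)} {i k : ℕ}
    (hΩ : 1 < k → {a | P.level a = i ∧ P.size {a} = k}.encard ≤ 2)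
    (hfg : ∀ d, {a ∈ P.hits i (f d) | P.size {a} = k}.ncard =
      {a ∈ P.hits i (g d) | P.size {a} = k}.ncard) :
    ∃ σ : Equiv.Perm {a // (P.level a, P.size {a}) = (i, k)}, ∀ a d,
      P.restrict (σ a : B) (g d) = 0 ↔ P.restrict (a : B) (f d) = 0 := by
  have := P.finite_blocks
  have hcard : (∀ a : {a // (P.level a, P.size {a}) = (i, k)},
      Subsingleton {v // P.block v = a}) ∨
        Nat.card {a // (P.level a, P.size {a}) = (i, k)} ≤ 2 := by
    rcases le_or_gt k 1 with hk | hk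
    · refine Or.inl fun a => Finite.card_le_one_iff_subsingleton.1 (le_trans (le_of_eq ?_) hk)
      exact (Prod.ext_iff.1 a.2).2
    · have h := hΩ hk
      rw [← Set.Finite.cast_ncard_eq (Set.toFinite _)] at h
      simp only [Prod.mk.injEq]
      exact Or.inr (by exact_mod_cast h)
  have hhits : ∀ x : V → ZMod 2, {a ∈ P.hits i x | P.size {a} = k}.ncard =
      {a : {a // (P.level a, P.size {a}) = (i, k)} | P.restrict (a : B) x ≠ 0}.ncard := fun x => by
    rw [← Set.ncard_image_of_injective _ Subtype.val_injective]
    congr 1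
    ext a
    simp [mem_hits_iff_restrict_ne_zero]
    tauto
  obtain ⟨σ, hσ⟩ := exists_perm_ker_eq hcard (f := fun a => P.restrict (a : B) ∘ₗ f)
    (g := fun a => P.restrict (a : B) ∘ₗ g) fun d => by
      simpa only [hhits, LinearMap.comp_apply] using hfg d
  exact ⟨σ, fun a d => SetLike.ext_iff.1 (hσ a) d⟩

theorem exists_perm_restrict_eq_zero_iff (hU : P.UniqueDecomposition) (hΩ : P.LevelwiseOmega)
    {D : Type*} [AddCommGroup D] [Module (ZMod 2) D] {f g : D →ₗ[ZMod 2] (V → ZMod 2)}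
    (hfg : ∀ d, P.weight (g d) = P.weight (f d)) :
    ∃ σ : Equiv.Perm B, (∀ a, P.level (σ a) = P.level a) ∧ (∀ a, P.size {σ a} = P.size {a}) ∧
      ∀ a d, f d ∈ P.low (ZMod 2) (P.level a + 1) →
        (P.restrict (σ a) (g d) = 0 ↔ P.restrict a (f d) = 0) := by
  obtain ⟨σ, hσ, hσfg⟩ := exists_perm_forall_of_fiber (fun a => (P.level a, P.size {a}))
    (R := fun a b => ∀ d, f d ∈ P.low (ZMod 2) (P.level a + 1) →
      (P.restrict b (g d) = 0 ↔ P.restrict a (f d) = 0)) (by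
    rintro ⟨i, k⟩
    let D' := (P.low (ZMod 2) (i + 1)).comap f
    obtain ⟨σ, hσ⟩ := exists_perm_fiber_restrict_eq_zero_iff (f := f ∘ₗ D'.subtype)
      (g := g ∘ₗ D'.subtype) (hΩ i k) fun d => hU.ncard_size_eq (fun _ ha => ha.1)
        (fun _ ha => ha.1) (size_hits_congr (hfg d).symm d.2) k
    refine ⟨σ, fun a d hd => hσ a ⟨d, ?_⟩⟩
    have ha : P.level (a : B) = i := (Prod.ext_iff.1 a.2).1
    rwa [ha] at hd)
  exact ⟨σ, fun a => (Prod.ext_iff.1 (hσ a)).1, fun a => (Prod.ext_iff.1 (hσ a)).2, hσfg⟩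

theorem extensionProperty_iff :
    P.ExtensionProperty (ZMod 2) ↔ P.UniqueDecomposition ∧ P.LevelwiseOmega := by
  refine ⟨fun h => ⟨h.uniqueDecomposition, h.levelwiseOmega⟩, fun ⟨hU, hΩ⟩ C t ht => ?_⟩
  obtain ⟨σ, hlevel, hsize, hσ⟩ := exists_perm_restrict_eq_zero_iff hU hΩ (f := C.subtype) ht
  exact exists_isometry_apply_eq hlevel hsize hσ

end Sufficiency

end LeveledPartition

/-! ### Directed graphs -/

theorem height_lt_top_of_finite {α : Type*} [Preorder α] [Finite α] (a : α) :
    Order.height a < ⊤ := by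
  have := Fintype.ofFinite α
  rw [lt_top_iff_ne_top, Ne, Order.height_eq_top_iff]
  intro h
  obtain ⟨s, -, hs⟩ := h (Fintype.card α)
  have := Fintype.card_le_of_injective _ s.strictMono.injective
  rw [Fintype.card_fin, hs] at this
  omega

theorem proj_le_proj_iff {V : Type*} {G : Digraph V} {u v : V} :
    G.proj v ≤ G.proj u ↔ G.Dominates u v := by
  constructor
  · rintro ⟨v', u', hv, hu, h⟩
    exact ((G.proj_eq_iff.1 hu).2.trans (G.mem_clo_singleton.1 h)).trans (G.proj_eq_iff.1 hv).1
  · exact fun h => ⟨v, u, rfl, rfl, G.mem_clo_singleton.2 h⟩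

namespace LeveledPartition

section OfDigraph

variable {V F : Type*} [Field F] {G : Digraph V}

/-- The vertices of a directed graph partitioned into strongly connected components, each with its
height in `P_G` as level. For an infinite graph the height may be infinite, and the level is then
the junk value `0`. -/
noncomputable def ofDigraph (G : Digraph V) : LeveledPartition V G.RedVert where
  block := G.proj
  block_surjective := Quotient.exists_rep
  level a := (G.redHeight a).toNat

variable [Finite V]

theorem coe_level_ofDigraph (a : G.RedVert) : ((ofDigraph G).level a : ℕ∞) = G.redHeight a := by
  have := (ofDigraph G).finite_blocks
  exact ENat.natCast_toNat (WithTop.add_ne_top.2 ⟨(height_lt_top_of_finite a).ne, ENat.one_ne_top⟩)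

theorem level_ofDigraph_eq_iff {a : G.RedVert} {i : ℕ} :
    (ofDigraph G).level a = i ↔ a ∈ G.redLevel i := by
  rw [← ENat.natCast_inj, coe_level_ofDigraph]
  rfl

theorem level_ofDigraph_strictMono : StrictMono (ofDigraph G).level := by
  have := (ofDigraph G).finite_blocks
  intro a b hab
  rw [← ENat.natCast_lt_natCast, coe_level_ofDigraph, coe_level_ofDigraph]
  exact (ENat.add_lt_add_iff_right ENat.one_ne_top).2
    (Order.height_strictMono hab (height_lt_top_of_finite a))

theorem one_le_level_ofDigraph (a : G.RedVert) : 1 ≤ (ofDigraph G).level a := by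
  rw [← Nat.one_le_cast (α := ℕ∞), coe_level_ofDigraph]
  exact le_add_self

theorem le_of_level_ofDigraph_lt (hG : G.IsHierarchical) {a b : G.RedVert}
    (h : (ofDigraph G).level b < (ofDigraph G).level a) : b ≤ a := by
  have := (ofDigraph G).finite_blocks
  obtain ⟨c, hca, hc⟩ : ∃ c ≤ a, Order.height c = (ofDigraph G).level b := by
    rw [← ENat.natCast_lt_natCast, coe_level_ofDigraph a] at h
    rcases (Order.le_of_lt_add_one h).eq_or_lt with h | h
    · exact ⟨a, le_rfl, h.symm⟩
    · exact ((Order.coe_lt_height_iff (height_lt_top_of_finite a)).1 h).imp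
        fun c hc => ⟨hc.1.le, hc.2⟩
  have hclevel : c ∈ G.redLevel ((ofDigraph G).level b + 1) := congrArg (· + 1) hc
  have hblevel : b ∈ G.redLevel ((ofDigraph G).level b) := level_ofDigraph_eq_iff.1 rfl
  exact (hG _ (Nat.lt_add_of_pos_left (one_le_level_ofDigraph b)) c hclevel b hblevel).trans hca

theorem weight_ofDigraph (hG : G.IsHierarchical) (x : V → F) :
    (ofDigraph G).weight x = G.wt x := by
  have dominates_iff (u v : V) : G.Dominates u v ↔ G.proj u = G.proj v ∨
      (ofDigraph G).level (G.proj v) < (ofDigraph G).level (G.proj u) := by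
    rw [← proj_le_proj_iff]
    refine ⟨fun h => h.lt_or_eq.symm.imp Eq.symm fun h => level_ofDigraph_strictMono h, ?_⟩
    exact fun h => h.elim Eq.ge (le_of_level_ofDigraph_lt hG)
  rw [Digraph.wt, weight]
  congr 1
  ext v
  simp only [G.mem_clo, dominates_iff, Function.mem_support]
  rfl

theorem mem_linIsom_iff (hG : G.IsHierarchical) {T : (V → F) ≃ₗ[F] (V → F)} :
    T ∈ G.linIsom F ↔ ∀ x, (ofDigraph G).weight (T x) = (ofDigraph G).weight x := by
  change (∀ x y, G.wt (T y - T x) = G.wt (y - x)) ↔ _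
  simp only [weight_ofDigraph hG, ← map_sub]
  exact ⟨fun h x => by simpa using h 0 x, fun h x y => h _⟩

theorem macWilliamsExtension_iff_extensionProperty (hG : G.IsHierarchical) :
    G.MacWilliamsExtension F ↔ (ofDigraph G).ExtensionProperty F := by
  constructor
  · intro h C t ht
    obtain ⟨T, hT, hTt⟩ := h C ⊤ (t.codRestrict ⊤ fun _ => Submodule.mem_top)
      fun c => by simpa [weight_ofDigraph hG] using ht c
    exact ⟨T, (mem_linIsom_iff hG).1 hT, hTt⟩
  · intro h C C' t ht
    obtain ⟨T, hT, hTt⟩ := h C (C'.subtype ∘ₗ t)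
      fun c => by simpa [weight_ofDigraph hG] using ht c
    exact ⟨T, (mem_linIsom_iff hG).2 hT, hTt⟩

theorem udp_iff_uniqueDecomposition : G.UDP ↔ (ofDigraph G).UniqueDecomposition := by
  have := (ofDigraph G).finite_blocks
  constructor
  · intro h i S S' hS hS' hsize
    obtain ⟨S, rfl⟩ := S.toFinite.exists_finset_coe
    obtain ⟨S', rfl⟩ := S'.toFinite.exists_finset_coe
    obtain ⟨g, hg⟩ := h i S S' (fun a ha => level_ofDigraph_eq_iff.1 (hS a ha))
      (fun a ha => level_ofDigraph_eq_iff.1 (hS' a ha))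
      (by rwa [← sum_size_singleton, ← sum_size_singleton] at hsize)
    exact ⟨g, fun a => (hg a).symm⟩
  · intro h i S S' hS hS' hsum
    obtain ⟨g, hg⟩ := h i S S' (fun a ha => level_ofDigraph_eq_iff.2 (hS ha))
      (fun a ha => level_ofDigraph_eq_iff.2 (hS' ha))
      (by rwa [← sum_size_singleton, ← sum_size_singleton])
    exact ⟨g, fun a => (hg a).symm⟩

end OfDigraph

end LeveledPartition

section Induced

variable {V : Type*} {G : Digraph V} {Y : Set G.RedVert}

theorem proj_inducedOn_eq_iff {u v : G.proj ⁻¹' Y} :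
    (G.inducedOn (G.proj ⁻¹' Y)).proj u = (G.inducedOn (G.proj ⁻¹' Y)).proj v ↔
      G.proj u = G.proj v := by
  rw [Digraph.proj_eq_iff, Digraph.proj_eq_iff]
  have dominates_of_inducedOn {u v : G.proj ⁻¹' Y}
      (h : (G.inducedOn (G.proj ⁻¹' Y)).Dominates u v) : G.Dominates u v :=
    Relation.ReflTransGen.lift Subtype.val (fun _ _ h => h) _ _ h
  have dominates_inducedOn (u : G.proj ⁻¹' Y) (w : V) (huw : G.Dominates u w) :
      G.Dominates w u →
        ∃ hw : w ∈ G.proj ⁻¹' Y, (G.inducedOn (G.proj ⁻¹' Y)).Dominates u ⟨w, hw⟩ := by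
    induction huw with
    | refl => exact fun _ => ⟨u.2, .refl⟩
    | @tail b c hub hbc ih =>
      intro hcu
      obtain ⟨hb, hdom⟩ := ih (Relation.ReflTransGen.head hbc hcu)
      have hproj : G.proj c = G.proj u := G.proj_eq_iff.2 ⟨hcu, hub.tail hbc⟩
      exact ⟨by rw [Set.mem_preimage, hproj]; exact u.2, hdom.tail hbc⟩
  exact ⟨fun h => ⟨dominates_of_inducedOn h.1, dominates_of_inducedOn h.2⟩,
    fun h => ⟨(dominates_inducedOn u v h.1 h.2).2, (dominates_inducedOn v u h.2 h.1).2⟩⟩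

theorem redWeight_inducedOn_proj (u : G.proj ⁻¹' Y) :
    (G.inducedOn (G.proj ⁻¹' Y)).redWeight ((G.inducedOn (G.proj ⁻¹' Y)).proj u) =
      G.redWeight (G.proj u) := by
  rw [Digraph.redWeight, Digraph.redWeight,
    ← Set.ncard_image_of_injective _ Subtype.val_injective]
  congr 1
  ext v
  constructor
  · rintro ⟨v, hv, rfl⟩
    exact proj_inducedOn_eq_iff.1 hv
  · intro (hv : G.proj v = G.proj u)
    have hvY : v ∈ G.proj ⁻¹' Y := by
      rw [Set.mem_preimage, hv]
      exact u.2
    exact ⟨⟨v, hvY⟩, proj_inducedOn_eq_iff.2 hv, rfl⟩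

theorem encard_redWeight_inducedOn_eq (Y : Set G.RedVert) (k : ℕ) :
    {a | (G.inducedOn (G.proj ⁻¹' Y)).redWeight a = k}.encard =
      {a | a ∈ Y ∧ G.redWeight a = k}.encard := by
  let f : (G.inducedOn (G.proj ⁻¹' Y)).RedVert → G.RedVert :=
    Quotient.lift (fun u : G.proj ⁻¹' Y => G.proj u)
      fun _ _ h => proj_inducedOn_eq_iff.1 (Quotient.sound h)
  have hinj : Function.Injective f :=
    Quotient.ind₂ fun _ _ h => proj_inducedOn_eq_iff.2 h
  rw [← hinj.encard_image]
  congr 1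
  ext a
  constructor
  · rintro ⟨⟨u⟩, hu, rfl⟩
    exact ⟨u.2, (redWeight_inducedOn_proj u).symm.trans hu⟩
  · obtain ⟨u, rfl⟩ := Quotient.exists_rep a
    rintro ⟨hu, hk⟩
    exact ⟨_, (redWeight_inducedOn_proj ⟨u, hu⟩).trans hk, rfl⟩

end Induced

namespace LeveledPartition

variable {V : Type*} [Finite V] {G : Digraph V}

theorem conditionOmega_level_iff {i : ℕ} : (G.inducedOn (G.level i)).ConditionOmega ↔
    ∀ k, 1 < k →
      {a | (ofDigraph G).level a = i ∧ (ofDigraph G).size {a} = k}.encard ≤ 2 := by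
  refine forall₂_congr fun k _ => ?_
  rw [Digraph.level, encard_redWeight_inducedOn_eq]
  simp only [level_ofDigraph_eq_iff]
  rfl

theorem forall_conditionOmega_iff_levelwiseOmega :
    (∀ i : ℕ, 1 ≤ i → (i : ℕ∞) ≤ G.numLevels → (G.inducedOn (G.level i)).ConditionOmega) ↔
      (ofDigraph G).LevelwiseOmega := by
  simp only [conditionOmega_level_iff]
  refine ⟨fun h i k hk => ?_, fun h i _ _ => h i⟩
  by_cases hi : ∃ a, (ofDigraph G).level a = i
  · obtain ⟨a, rfl⟩ := hi
    exact h _ (one_le_level_ofDigraph a)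
      ((coe_level_ofDigraph a).trans_le (le_iSup G.redHeight a)) k hk
  · have hempty : {a | (ofDigraph G).level a = i ∧ (ofDigraph G).size {a} = k} = ∅ :=
      Set.eq_empty_of_forall_notMem fun a ha => hi ⟨a, ha.1⟩
    rw [hempty, Set.encard_empty]
    exact zero_le

end LeveledPartition

theorem mainTheorem11 {V : Type*} [Finite V] (G : Digraph V) (hG : G.IsHierarchical) :
    G.MacWilliamsExtension (ZMod 2) ↔
      G.UDP ∧ ∀ i : ℕ, 1 ≤ i → (i : ℕ∞) ≤ G.numLevels →
        (G.inducedOn (G.level i)).ConditionOmega := by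
  rw [LeveledPartition.macWilliamsExtension_iff_extensionProperty hG,
    LeveledPartition.extensionProperty_iff, LeveledPartition.udp_iff_uniqueDecomposition,
    LeveledPartition.forall_conditionOmega_iff_levelwiseOmega]
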